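/- There is a universal constant $K>0$ with the following property. Let $(\mathcal Z,\mathcal D)$ be a probability space (the data space with the data distribution), $d\ge 0$, $n\ge 1$, $N\ge 0$ integers, and let $f,\ell:\mathbb R^d\times\mathcal Z\to\mathbb R$ be measurable functions (the objective and the loss) such that $f(\cdot;z)$ is differentiable for every $z$, $$\|\nabla f(w;z)-\nabla f(w;z')\|\le L\qquad\text{for all } z,z'\in\mathcal Z,\ w\in\mathbb R^d,$$ and $|\ell(w;z)|\le C$ for all $w,z$. Let $\beta>0$, $\sigma_0\ge 0$ and $\eta_k\ge 0$ for $k\ge 1$. For a sample $S=(z_1,\dots,z_n)\in\mathcal Z^n$ let $w_0\sim\mathcal N(0,\sigma_0^2I_d)$ and let full-gradient Langevin Monte Carlo (LMC) be the iteration $$w_{k}=w_{k-1}-\frac{\eta_k}{n}\sum_{i=1}^n\nabla f(w_{k-1};z_i)+\sqrt{\frac{2\eta_k}{\beta}}\,\xi_k,\qquad k=1,2,\dots,$$ where $\xi_1,\xi_2,\dots\sim\mathcal N(0,I_d)$ are independent of each other and of $w_0$. Let $w_N$ be the result of the $N$-th round and $$\mathrm{err}(w_N)=\mathbb E_{\mathcal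 A}\Big[\mathbb E_{z\sim\mathcal D}\,\ell(w_N;z)-\frac1n\sum_{i=1}^n\ell(w_N;z_i)\Big],$$ where $\mathbb E_{\mathcal A}$ is the expectation over $w_0$ and the noise $(\xi_k)$ with $S$ fixed. Then, if $S$ consists of $n$ independent draws from $\mathcal D$, independent of $w_0$ and of $(\xi_k)$, $$\big|\mathbb E_{S}[\mathrm{err}(w_N)]\big|\le K\,C\,\frac{L\sqrt{\beta\sum_{k=1}^N\eta_k}}{n}.$$ -/

import Mathlib

open MeasureTheory ProbabilityTheory

/-- The iterates of full-gradient Langevin Monte Carlo on the sample `S = (z_1, …, z_n)`, as a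
function of the realized initial point `w₀` and of the realized noise vectors `ξ 1, ξ 2, …`.
Round `k + 1` uses the step size `η (k + 1)` and the noise vector `ξ (k + 1)`:
`w_{k+1} = w_k - (η_{k+1} / n) ∑ i, ∇f(w_k; z_i) + √(2 η_{k+1} / β) ξ_{k+1}`. -/
noncomputable def lmcIterate {d n : ℕ} {Z : Type*}
    (f : EuclideanSpace ℝ (Fin d) → Z → ℝ) (β : ℝ) (η : ℕ → ℝ) (S : Fin n → Z)
    (w₀ : EuclideanSpace ℝ (Fin d)) (ξ : ℕ → EuclideanSpace ℝ (Fin d)) :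
    ℕ → EuclideanSpace ℝ (Fin d)
  | 0 => w₀
  | k + 1 =>
      lmcIterate f β η S w₀ ξ k
        - (η (k + 1) / n) •
          ∑ i, gradient (fun v => f v (S i)) (lmcIterate f β η S w₀ ξ k)
        + √(2 * η (k + 1) / β) • ξ (k + 1)

/-- The generalization error, on the sample `S` and for the data distribution `D`, of a random
parameter `W` on the probability space `(Ω, P)` (the randomness of the algorithm): the expectation
over `P` of the population loss minus the empirical loss. -/
noncomputable def genError {d n : ℕ} {Z Ω : Type*} [MeasurableSpace Z] [MeasurableSpace Ω]
    (ℓ : EuclideanSpace ℝ (Fin d) → Z → ℝ) (D : Measure Z) (P : Measure Ω)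
    (S : Fin n → Z) (W : Ω → EuclideanSpace ℝ (Fin d)) : ℝ :=
  ∫ ω, ((∫ z, ℓ (W ω) z ∂D) - (1 / (n : ℝ)) * ∑ i, ℓ (W ω) (S i)) ∂P

/-! The bound is algorithmic stability. If replacing one data point changes the expected loss at
every test point by at most δ, then exchanging z_i with an independent draw bounds the expected
generalization gap by δ (`abs_integral_sub_avg_le_of_stable`).

Stability comes from the injected noise. From a common w, the two transitions are Gaussians with
covariance (2η/β)I whose means differ by at most ηL/n, so 1 + χ² ≤ exp(βηL²/(2n²)). This is uniform
in w, hence the factors multiply along the chain (`map_prod`), and the laws of w_N satisfy 1 + χ² ≤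
exp(D²/2) with D = L√(β∑η)/n. The expectation of a loss bounded by C then moves by at most
C√(exp(D²/2) - 1) (`sq_integral_sub_le`), which is of order CD for small D; for large D the trivial
bound 2C suffices.

Domination is stated through test functions rather than densities, so push-forwards and mixtures
follow directly, and zero step sizes, where the noise vanishes, are covered. -/

/-- `ChiSqDominated μ' μ A` says that `(∫ g dμ')² ≤ A ∫ g² dμ` for all measurable `g ≥ 0`; for
probability measures this bounds the `χ²`-divergence of `μ'` from `μ` by `A - 1`. -/
def ChiSqDominated {α : Type*} [MeasurableSpace α] (μ' μ : Measure α) (A : ENNReal) : Prop :=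
  ∀ g : α → ENNReal, Measurable g → (∫⁻ x, g x ∂μ') ^ 2 ≤ A * ∫⁻ x, g x ^ 2 ∂μ

lemma sq_lintegral_mul_le {α : Type*} [MeasurableSpace α] (μ : Measure α) {g r : α → ENNReal}
    (hg : Measurable g) (hr : Measurable r) :
    (∫⁻ x, g x * r x ∂μ) ^ 2 ≤ (∫⁻ x, r x ^ 2 ∂μ) * ∫⁻ x, g x ^ 2 ∂μ := by
  have h := ENNReal.lintegral_mul_le_Lp_mul_Lq μ Real.HolderConjugate.two_two hg.aemeasurable
    hr.aemeasurable
  simp only [Pi.mul_apply, ENNReal.rpow_two] at h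
  have hsq : ∀ x : ENNReal, (x ^ (1 / 2 : ℝ)) ^ 2 = x := fun x => by
    rw [← ENNReal.rpow_two, ← ENNReal.rpow_mul]; norm_num
  calc _ ≤ _ := pow_le_pow_left' h 2
    _ = _ := by rw [mul_pow, hsq, hsq, mul_comm]

/-! ### Calculus of χ²-domination -/

namespace ChiSqDominated

variable {α β γ : Type*} [MeasurableSpace α] [MeasurableSpace β] [MeasurableSpace γ]

lemma self_of_one_le (μ : Measure α) [IsProbabilityMeasure μ] {A : ENNReal} (hA : 1 ≤ A) :
    ChiSqDominated μ μ A := by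
  intro g hg
  have h := sq_lintegral_mul_le μ hg (measurable_const (a := (1 : ENNReal)))
  simp only [mul_one, one_pow, lintegral_const, measure_univ] at h
  exact h.trans (by gcongr)

lemma map {μ' μ : Measure α} {A : ENNReal} (h : ChiSqDominated μ' μ A) {F : α → β}
    (hF : Measurable F) : ChiSqDominated (μ'.map F) (μ.map F) A := by
  intro g hg
  rw [lintegral_map hg hF, lintegral_map (hg.pow_const 2) hF]
  exact h _ (hg.comp hF)

/-- Both measures are pushed forward by a Markov transition driven by the same noise `ν`. -/
lemma map_prod {μ' μ : Measure α} {ν : Measure β} [SFinite ν] [SFinite μ] [SFinite μ']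
    {A B : ENNReal}
    (h : ChiSqDominated μ' μ A) {F' F : α × β → γ} (hF' : Measurable F') (hF : Measurable F)
    (hB : ∀ x, ChiSqDominated (ν.map fun y => F' (x, y)) (ν.map fun y => F (x, y)) B) :
    ChiSqDominated ((μ'.prod ν).map F') ((μ.prod ν).map F) (A * B) := by
  intro g hg
  rw [lintegral_map hg hF', lintegral_map (hg.pow_const 2) hF,
    lintegral_prod (fun p => g (F' p)) (hg.comp hF').aemeasurable,
    lintegral_prod (fun p => g (F p) ^ 2) ((hg.pow_const 2).comp hF).aemeasurable]
  have hm : Measurable fun x => ∫⁻ y, g (F' (x, y)) ∂ν := (hg.comp hF').lintegral_prod_right'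
  have hm2 : Measurable fun x => ∫⁻ y, g (F (x, y)) ^ 2 ∂ν :=
    ((hg.pow_const 2).comp hF).lintegral_prod_right'
  -- The outer domination is applied to the fibre integral, whose square `hB` then bounds for each
  -- `x`.
  refine (h _ hm).trans ?_
  rw [mul_assoc, ← lintegral_const_mul _ hm2]
  gcongr with x
  have := hB x g hg
  rwa [lintegral_map hg (by fun_prop), lintegral_map (hg.pow_const 2) (by fun_prop)] at this

lemma prod {μ' μ : Measure α} {ν' ν : Measure β} [SFinite ν] [SFinite μ] [SFinite μ'] [SFinite ν']
    {A B : ENNReal} (h : ChiSqDominated μ' μ A) (hB : ChiSqDominated ν' ν B) :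
    ChiSqDominated (μ'.prod ν') (μ.prod ν) (A * B) := by
  intro g hg
  rw [lintegral_prod _ hg.aemeasurable, lintegral_prod _ (hg.pow_const 2).aemeasurable]
  refine (h _ hg.lintegral_prod_right').trans ?_
  rw [mul_assoc, ← lintegral_const_mul _ (hg.pow_const 2).lintegral_prod_right']
  gcongr with x
  exact hB _ (hg.comp measurable_prodMk_left)

lemma pi {n : ℕ} {μ' μ : Fin n → Measure α} [∀ i, IsProbabilityMeasure (μ' i)]
    [∀ i, IsProbabilityMeasure (μ i)] {A : Fin n → ENNReal}
    (h : ∀ i, ChiSqDominated (μ' i) (μ i) (A i)) :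
    ChiSqDominated (Measure.pi μ') (Measure.pi μ) (∏ i, A i) := by
  induction n with
  | zero =>
    rw [show μ' = μ from funext fun i => i.elim0]
    exact self_of_one_le _ (by simp)
  | succ n ih =>
    have h1 := (measurePreserving_piFinSuccAbove μ 0).symm.map_eq
    have h2 := (measurePreserving_piFinSuccAbove μ' 0).symm.map_eq
    rw [← h1, ← h2, Fin.prod_univ_succ]
    exact ((h 0).prod (ih fun i => h i.succ)).map (MeasurableEquiv.measurable _)

/-- Cauchy–Schwarz against the likelihood ratio `r`. Completing the square turns density times `r²`
into `exp (a²)` times the density of N(2a, 1), so the second moment of `r` is `exp (a²)`. -/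
lemma gaussianReal (a : ℝ) :
    ChiSqDominated (gaussianReal a 1) (gaussianReal 0 1) (ENNReal.ofReal (Real.exp (a ^ 2))) := by
  intro g hg
  set r : ℝ → ENNReal := fun x => ENNReal.ofReal (Real.exp (a * x - a ^ 2 / 2)) with hr
  have hrm : Measurable r := by fun_prop
  have h1 : ∀ x, gaussianPDF a 1 x = gaussianPDF 0 1 x * r x := fun x => by
    rw [gaussianPDF, gaussianPDF, hr, ← ENNReal.ofReal_mul (gaussianPDFReal_nonneg _ _ _)]
    simp only [gaussianPDFReal]
    rw [mul_assoc (√_)⁻¹ _ (Real.exp (a * x - a ^ 2 / 2)), ← Real.exp_add]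
    congr 3
    simp only [NNReal.coe_one]; ring
  have h2 : ∀ x, gaussianPDF 0 1 x * r x ^ 2
      = ENNReal.ofReal (Real.exp (a ^ 2)) * gaussianPDF (2 * a) 1 x := fun x => by
    rw [gaussianPDF, gaussianPDF, hr, ← ENNReal.ofReal_pow (Real.exp_nonneg _),
      ← ENNReal.ofReal_mul (gaussianPDFReal_nonneg _ _ _), ← ENNReal.ofReal_mul (Real.exp_nonneg _)]
    simp only [gaussianPDFReal]
    rw [← Real.exp_nat_mul, mul_left_comm (Real.exp (a ^ 2)), mul_assoc, ← Real.exp_add,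
      ← Real.exp_add]
    congr 3
    simp only [NNReal.coe_one]; push_cast; ring
  have h3 : ∫⁻ x, g x ∂(ProbabilityTheory.gaussianReal a 1)
      = ∫⁻ x, g x * r x ∂(ProbabilityTheory.gaussianReal 0 1) := by
    rw [gaussianReal_of_var_ne_zero _ one_ne_zero, gaussianReal_of_var_ne_zero _ one_ne_zero,
      lintegral_withDensity_eq_lintegral_mul _ (measurable_gaussianPDF _ _) hg,
      lintegral_withDensity_eq_lintegral_mul _ (measurable_gaussianPDF _ _)
        (show Measurable fun x => g x * r x from hg.mul hrm)]
    refine lintegral_congr fun x => ?_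
    simp only [Pi.mul_apply, h1]; ring
  have h4 : ∫⁻ x, r x ^ 2 ∂(ProbabilityTheory.gaussianReal 0 1)
      = ENNReal.ofReal (Real.exp (a ^ 2)) := by
    rw [gaussianReal_of_var_ne_zero _ one_ne_zero,
      lintegral_withDensity_eq_lintegral_mul _ (measurable_gaussianPDF _ _) (hrm.pow_const 2)]
    simp only [Pi.mul_apply, h2]
    rw [lintegral_const_mul _ (measurable_gaussianPDF _ _),
      lintegral_gaussianPDF_eq_one _ one_ne_zero, mul_one]
  rw [h3, ← h4]
  exact sq_lintegral_mul_le _ hg hrm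

lemma stdGaussian_add {d : ℕ} (a : EuclideanSpace ℝ (Fin d)) :
    ChiSqDominated ((stdGaussian (EuclideanSpace ℝ (Fin d))).map fun x => x + a)
      (stdGaussian (EuclideanSpace ℝ (Fin d))) (ENNReal.ofReal (Real.exp (‖a‖ ^ 2))) := by
  have h := (pi fun i => gaussianReal (a i)).map
    (WithLp.measurable_toLp 2 (Fin d → ℝ))
  have hA : ∏ i, ENNReal.ofReal (Real.exp (a i ^ 2)) = ENNReal.ofReal (Real.exp (‖a‖ ^ 2)) := by
    rw [← ENNReal.ofReal_prod_of_nonneg fun i _ => Real.exp_nonneg _, ← Real.exp_sum,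
      EuclideanSpace.real_norm_sq_eq]
  have hpi : Measure.pi (fun i => ProbabilityTheory.gaussianReal (a i) 1)
      = (Measure.pi fun _ : Fin d => ProbabilityTheory.gaussianReal 0 1).map
        fun x i => x i + a i := by
    rw [Measure.pi_map_pi (f := fun (i : Fin d) (x : ℝ) => x + a i) fun i => by fun_prop]
    simp [gaussianReal_map_add_const]
  rw [hA, hpi, Measure.map_map (WithLp.measurable_toLp 2 _) (by fun_prop)] at h
  rw [← map_pi_eq_stdGaussian, Measure.map_map (by fun_prop) (WithLp.measurable_toLp 2 _)]
  exact h

/-- Here `r` bounds the mean shift in units of the standard deviation `s`. Writing this as a product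
allows `s = 0`, where the means must coincide. -/
lemma stdGaussian_affine {d : ℕ} (m' m : EuclideanSpace ℝ (Fin d)) {s r : ℝ} (hs : 0 ≤ s)
    (h : ‖m' - m‖ ≤ s * r) :
    ChiSqDominated ((stdGaussian (EuclideanSpace ℝ (Fin d))).map fun x => m' + s • x)
      ((stdGaussian (EuclideanSpace ℝ (Fin d))).map fun x => m + s • x)
      (ENNReal.ofReal (Real.exp (r ^ 2))) := by
  rcases hs.eq_or_lt with rfl | hs
  · rw [zero_mul, norm_le_zero_iff, sub_eq_zero] at h
    rw [h]
    have := Measure.isProbabilityMeasure_map (μ := stdGaussian (EuclideanSpace ℝ (Fin d)))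
      (f := fun x => m + (0 : ℝ) • x) (by fun_prop)
    refine self_of_one_le _ ?_
    rw [ENNReal.one_le_ofReal]
    exact Real.one_le_exp (sq_nonneg r)
  · set a := s⁻¹ • (m' - m) with ha
    have hle : ‖a‖ ≤ r := by
      rw [ha, norm_smul, norm_inv, Real.norm_of_nonneg hs.le, inv_mul_le_iff₀ hs]
      exact h
    have hg := (stdGaussian_add a).map (F := fun x => m + s • x) (by fun_prop)
    rw [Measure.map_map (by fun_prop) (by fun_prop)] at hg
    have hF : ((fun x => m + s • x) ∘ fun x => x + a) = fun x => m' + s • x := by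
      funext x
      simp only [Function.comp, ha, smul_add, smul_inv_smul₀ hs.ne']
      abel
    rw [hF] at hg
    intro g hgm
    refine (hg g hgm).trans ?_
    gcongr

lemma sq_integral_le {μ' μ : Measure α} {A : ℝ} (hA : 0 ≤ A)
    (h : ChiSqDominated μ' μ (ENNReal.ofReal A)) {g : α → ℝ} (hg : Measurable g)
    (hint : Integrable (fun x => g x ^ 2) μ) : (∫ x, g x ∂μ') ^ 2 ≤ A * ∫ x, g x ^ 2 ∂μ := by
  have h1 := h (fun x => ‖g x‖ₑ) hg.enorm
  have h2 : ∫⁻ x, ‖g x‖ₑ ^ 2 ∂μ = ENNReal.ofReal (∫ x, g x ^ 2 ∂μ) := by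
    rw [ofReal_integral_eq_lintegral_ofReal hint (ae_of_all _ fun x => sq_nonneg _)]
    refine lintegral_congr fun x => ?_
    rw [← enorm_pow, Real.enorm_of_nonneg (sq_nonneg _)]
  have h3 := (pow_le_pow_left' (enorm_integral_le_lintegral_enorm (μ := μ') g) 2).trans h1
  rw [h2, ← ENNReal.ofReal_mul hA, ← enorm_pow, Real.enorm_of_nonneg (sq_nonneg _)] at h3
  exact (ENNReal.ofReal_le_ofReal_iff
    (mul_nonneg hA (integral_nonneg fun x => sq_nonneg _))).1 h3

/-- Testing on `1 + t * (g - m)` for all real `t`, rather than on `g`, gives a nonnegative quadratic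
in `t`. Its discriminant yields `y² ≤ (A - 1) v`, with `v` the variance of `g`; the gain is `A - 1`
in place of `A`. -/
lemma sq_integral_sub_le {μ' μ : Measure α} [IsProbabilityMeasure μ'] [IsProbabilityMeasure μ]
    {A C : ℝ} (hA : 1 ≤ A) (h : ChiSqDominated μ' μ (ENNReal.ofReal A)) {g : α → ℝ}
    (hg : Measurable g) (hC : ∀ x, |g x| ≤ C) :
    (∫ x, g x ∂μ' - ∫ x, g x ∂μ) ^ 2 ≤ (A - 1) * C ^ 2 := by
  have hi : ∀ ρ : Measure α, IsProbabilityMeasure ρ → Integrable g ρ := fun ρ _ =>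
    Integrable.of_bound hg.aestronglyMeasurable C (ae_of_all _ hC)
  have hi2 : Integrable (fun x => g x ^ 2) μ := by
    refine Integrable.of_bound (hg.pow_const 2).aestronglyMeasurable (C ^ 2) (ae_of_all _ fun x => ?_)
    rw [Real.norm_eq_abs, abs_pow]
    exact pow_le_pow_left₀ (abs_nonneg _) (hC x) 2
  set m := ∫ x, g x ∂μ with hm
  set y := ∫ x, g x ∂μ' - m with hy
  set v := ∫ x, g x ^ 2 ∂μ - m ^ 2 with hv
  have hvC : v ≤ C ^ 2 := by
    have : ∫ x, g x ^ 2 ∂μ ≤ ∫ _, C ^ 2 ∂μ :=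
      integral_mono hi2 (integrable_const _) fun x => sq_le_sq' (abs_le.1 (hC x)).1 (abs_le.1 (hC x)).2
    simp only [integral_const, probReal_univ, one_smul] at this
    nlinarith [sq_nonneg m]
  have key : ∀ t : ℝ, 0 ≤ (A * v - y ^ 2) * (t * t) + (-2 * y) * t + (A - 1) := fun t => by
    have e1 : ∫ x, (1 + t * (g x - m)) ∂μ' = 1 + t * y := by
      rw [integral_add (integrable_const _) 
          (show Integrable (fun x => t * (g x - m)) μ' from
            ((hi μ' ‹_›).sub (integrable_const _)).const_mul _),
        integral_const_mul, integral_sub (hi μ' ‹_›) (integrable_const _)]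
      simp [hy]
    have hexp : ∀ x, (1 + t * (g x - m)) ^ 2
        = ((1 - t * m) ^ 2 + 2 * t * (1 - t * m) * g x) + t ^ 2 * g x ^ 2 := fun x => by ring
    have hI : Integrable (fun x => (1 - t * m) ^ 2 + 2 * t * (1 - t * m) * g x) μ :=
      (integrable_const _).add ((hi μ ‹_›).const_mul _)
    have e2 : ∫ x, (1 + t * (g x - m)) ^ 2 ∂μ = 1 + t ^ 2 * v := by
      simp_rw [hexp]
      rw [integral_add hI (hi2.const_mul _),
        integral_add (integrable_const _) ((hi μ ‹_›).const_mul _), integral_const_mul,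
        integral_const_mul, ← hm]
      simp only [integral_const, probReal_univ, one_smul, hv]
      ring
    have := h.sq_integral_le (zero_le_one.trans hA) (g := fun x => 1 + t * (g x - m)) (by fun_prop)
      (by simp_rw [hexp]; exact hI.add (hi2.const_mul _))
    rw [e1, e2] at this
    nlinarith
  have hd := discrim_le_zero key
  rw [discrim] at hd
  have : A * y ^ 2 ≤ A * ((A - 1) * v) := by nlinarith
  have := le_of_mul_le_mul_left this (zero_lt_one.trans_le hA)
  exact this.trans (mul_le_mul_of_nonneg_left hvC (sub_nonneg.2 hA))

end ChiSqDominated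

/-! ### Measurability and locality of the iteration -/

/-- Directional derivatives are pointwise limits of jointly measurable difference quotients, and
they give the coordinates of the gradient. -/
lemma measurable_gradient_uncurry {d : ℕ} {Z : Type*} [MeasurableSpace Z]
    {f : EuclideanSpace ℝ (Fin d) → Z → ℝ} (hf : Measurable (Function.uncurry f))
    (hd : ∀ z, Differentiable ℝ fun w => f w z) :
    Measurable fun p : EuclideanSpace ℝ (Fin d) × Z => gradient (fun v => f v p.2) p.1 := by
  have hcoord : ∀ v : EuclideanSpace ℝ (Fin d),
      Measurable fun p : EuclideanSpace ℝ (Fin d) × Z => fderiv ℝ (fun v => f v p.2) p.1 v := by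
    intro v
    refine measurable_of_tendsto_metrizable (f := fun (k : ℕ) (p : EuclideanSpace ℝ (Fin d) × Z) =>
      (k : ℝ) • (f (p.1 + (k : ℝ)⁻¹ • v) p.2 - f p.1 p.2)) (fun k => ?_) ?_
    · have h1 : Measurable fun p : EuclideanSpace ℝ (Fin d) × Z => f (p.1 + (k : ℝ)⁻¹ • v) p.2 :=
        hf.comp (f := fun p : EuclideanSpace ℝ (Fin d) × Z => (p.1 + (k : ℝ)⁻¹ • v, p.2))
          (by fun_prop)
      exact (h1.sub hf).const_smul (k : ℝ)
    · rw [tendsto_pi_nhds]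
      exact fun p => ((hd p.2 p.1).hasFDerivAt.lim_real v).comp tendsto_natCast_atTop_atTop
  have hsum : (fun p : EuclideanSpace ℝ (Fin d) × Z => gradient (fun v => f v p.2) p.1)
      = fun p => ∑ i, fderiv ℝ (fun v => f v p.2) p.1 (EuclideanSpace.basisFun (Fin d) ℝ i)
          • EuclideanSpace.basisFun (Fin d) ℝ i := by
    funext p
    rw [← (EuclideanSpace.basisFun (Fin d) ℝ).sum_repr' (gradient _ _)]
    simp only [inner_gradient_right, conj_trivial]
  rw [hsum]
  exact Finset.measurable_sum _ fun i _ => (hcoord _).smul_const _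

lemma abs_integral_le_of_forall_abs_le {α : Type*} [MeasurableSpace α] (μ : Measure α)
    [IsProbabilityMeasure μ] {g : α → ℝ} {C : ℝ} (h : ∀ x, |g x| ≤ C) : |∫ x, g x ∂μ| ≤ C := by
  have := norm_integral_le_of_norm_le_const (μ := μ) (f := g) (C := C) (ae_of_all _ h)
  rwa [probReal_univ, mul_one] at this

section lmcIterate

variable {d n : ℕ} {Z : Type*} {f : EuclideanSpace ℝ (Fin d) → Z → ℝ}

/-- The iterate only sees past noise; this is what makes it independent of the next noise vector. -/
lemma lmcIterate_congr (β : ℝ) (η : ℕ → ℝ) (S : Fin n → Z) (w₀ : EuclideanSpace ℝ (Fin d))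
    {ξ ξ' : ℕ → EuclideanSpace ℝ (Fin d)} {k : ℕ} (h : ∀ j ≤ k, ξ j = ξ' j) :
    lmcIterate f β η S w₀ ξ k = lmcIterate f β η S w₀ ξ' k := by
  induction k with
  | zero => rfl
  | succ k ih =>
    simp only [lmcIterate]
    rw [ih fun j hj => h j (hj.trans k.le_succ), h (k + 1) le_rfl]

lemma measurable_lmcIterate [MeasurableSpace Z] (hf : Measurable (Function.uncurry f))
    (hd : ∀ z, Differentiable ℝ fun w => f w z) (β : ℝ) (η : ℕ → ℝ) {α : Type*}
    [MeasurableSpace α] {S : α → Fin n → Z} (hS : Measurable S)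
    {w₀ : α → EuclideanSpace ℝ (Fin d)} (hw₀ : Measurable w₀)
    {ξ : α → ℕ → EuclideanSpace ℝ (Fin d)} (hξ : Measurable ξ) (k : ℕ) :
    Measurable fun a => lmcIterate f β η (S a) (w₀ a) (ξ a) k := by
  induction k with
  | zero => exact hw₀
  | succ k ih =>
    have hsum : Measurable fun a => ∑ i,
        gradient (fun v => f v (S a i)) (lmcIterate f β η (S a) (w₀ a) (ξ a) k) :=
      Finset.measurable_sum _ fun i _ =>
        (measurable_gradient_uncurry hf hd).comp (ih.prodMk ((measurable_pi_apply i).comp hS))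
    have hnoise : Measurable fun a => ξ a (k + 1) := (measurable_pi_apply (k + 1)).comp hξ
    exact (ih.sub (hsum.const_smul (η (k + 1) / n : ℝ))).add
      (hnoise.const_smul √(2 * η (k + 1) / β))

lemma norm_sum_gradient_update_sub_le {L : ℝ}
    (hL : ∀ z z' w, ‖gradient (fun v => f v z) w - gradient (fun v => f v z') w‖ ≤ L)
    (S : Fin n → Z) (i : Fin n) (z : Z) (w : EuclideanSpace ℝ (Fin d)) :
    ‖∑ j, gradient (fun v => f v (S j)) w
      - ∑ j, gradient (fun v => f v (Function.update S i z j)) w‖ ≤ L := by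
  rw [← Finset.sum_sub_distrib, Finset.sum_eq_single i]
  · exact hL _ _ _
  · intro j _ hj
    rw [Function.update_of_ne hj, sub_self]
  · simp

end lmcIterate

/-- Independence is associative. -/
lemma ProbabilityTheory.IndepFun.prodMk_left_of_prodMk_right {Ω α β γ : Type*} [MeasurableSpace Ω]
    [MeasurableSpace α] [MeasurableSpace β] [MeasurableSpace γ] {P : Measure Ω}
    [IsProbabilityMeasure P] {X : Ω → α} {Y : Ω → β} {T : Ω → γ} (hX : Measurable X)
    (hY : Measurable Y) (hT : Measurable T) (h : IndepFun X (fun ω => (Y ω, T ω)) P)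
    (hYT : IndepFun Y T P) : IndepFun (fun ω => (X ω, Y ω)) T P := by
  have := Measure.isProbabilityMeasure_map (μ := P) hX.aemeasurable
  have := Measure.isProbabilityMeasure_map (μ := P) hY.aemeasurable
  have := Measure.isProbabilityMeasure_map (μ := P) hT.aemeasurable
  have hXY : IndepFun X Y P := h.comp measurable_id measurable_fst
  rw [indepFun_iff_map_prod_eq_prod_map_map (hX.prodMk hY).aemeasurable hT.aemeasurable,
    hXY.map_prod_eq_prod_map_map hX.aemeasurable hY.aemeasurable]
  have e := h.map_prod_eq_prod_map_map hX.aemeasurable (hY.prodMk hT).aemeasurable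
  rw [hYT.map_prod_eq_prod_map_map hY.aemeasurable hT.aemeasurable,
    ← Measure.prodAssoc_prod] at e
  have e2 := congrArg (Measure.map MeasurableEquiv.prodAssoc.symm) e
  rw [Measure.map_map (MeasurableEquiv.measurable _) (by fun_prop),
    Measure.map_map (MeasurableEquiv.measurable _) (MeasurableEquiv.measurable _)] at e2
  simp only [MeasurableEquiv.symm_comp_self, Measure.map_id] at e2
  exact e2

/-! ### Stability of the Langevin iterates -/

section langevin

variable {d n : ℕ} {Z : Type*} [MeasurableSpace Z] {f : EuclideanSpace ℝ (Fin d) → Z → ℝ}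
  {Ω : Type*} [MeasurableSpace Ω] {P : Measure Ω} [IsProbabilityMeasure P]
  {w₀ : Ω → EuclideanSpace ℝ (Fin d)} {ξ : ℕ → Ω → EuclideanSpace ℝ (Fin d)}

lemma indepFun_lmcIterate (hf : Measurable (Function.uncurry f))
    (hd : ∀ z, Differentiable ℝ fun w => f w z) (β : ℝ) (η : ℕ → ℝ) (S : Fin n → Z)
    (hw₀ : Measurable w₀) (hξ : ∀ k, Measurable (ξ k)) (hind : iIndepFun ξ P)
    (hw₀ξ : IndepFun w₀ (fun ω k => ξ k ω) P) (k : ℕ) :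
    IndepFun (fun ω => lmcIterate f β η S (w₀ ω) (fun k => ξ k ω) k) (ξ (k + 1)) P := by
  set s := Finset.range (k + 1) with hs
  have hY : Measurable fun ω (j : s) => ξ j ω := measurable_pi_lambda _ fun j => hξ j
  have hYT : IndepFun (fun ω (j : s) => ξ j ω) (ξ (k + 1)) P :=
    (hind.indepFun_finset s {k + 1} (by simp [hs]) hξ).comp measurable_id
      (measurable_pi_apply (⟨k + 1, by simp⟩ : ({k + 1} : Finset ℕ)))
  have hX : IndepFun w₀ (fun ω => (fun (j : s) => ξ j ω, ξ (k + 1) ω)) P :=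
    hw₀ξ.comp (φ := id)
      (ψ := fun x : ℕ → EuclideanSpace ℝ (Fin d) => (fun (j : s) => x j, x (k + 1)))
      measurable_id (by fun_prop)
  have h := hX.prodMk_left_of_prodMk_right hw₀ hY (hξ (k + 1)) hYT
  -- The iterate as a function of `w₀` and the finitely many past noise vectors, the later ones
  -- being padded by `0`.
  set G : EuclideanSpace ℝ (Fin d) × (s → EuclideanSpace ℝ (Fin d)) → EuclideanSpace ℝ (Fin d) :=
    fun p => lmcIterate f β η S p.1 (fun j => if hj : j ∈ s then p.2 ⟨j, hj⟩ else 0) k with hG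
  have hGm : Measurable G := by
    refine measurable_lmcIterate hf hd β η measurable_const measurable_fst ?_ k
    refine measurable_pi_lambda _ fun j => ?_
    by_cases hj : j ∈ s
    · simp only [hj, dite_true]; fun_prop
    · simp only [hj, dite_false]; fun_prop
  have hGeq : (fun ω => lmcIterate f β η S (w₀ ω) (fun k => ξ k ω) k)
      = G ∘ fun ω => (w₀ ω, fun (j : s) => ξ j ω) := by
    funext ω
    refine lmcIterate_congr β η S _ fun j hj => ?_
    have : j ∈ s := by simp [hs]; omega
    simp [this]
  rw [hGeq]
  exact h.comp hGm measurable_id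

/-- Replacing one data point changes the law of the iterates by a bounded `χ²`-divergence. -/
lemma chiSqDominated_lmcIterate (hf : Measurable (Function.uncurry f))
    (hd : ∀ z, Differentiable ℝ fun w => f w z) {L : ℝ}
    (hL : ∀ z z' w, ‖gradient (fun v => f v z) w - gradient (fun v => f v z') w‖ ≤ L)
    {β : ℝ} (hβ : 0 < β) {η : ℕ → ℝ} (hη : ∀ k, 0 ≤ η k)
    (hw₀ : Measurable w₀) (hξ : ∀ k, Measurable (ξ k))
    (hξlaw : ∀ k, P.map (ξ k) = stdGaussian (EuclideanSpace ℝ (Fin d))) (hind : iIndepFun ξ P)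
    (hw₀ξ : IndepFun w₀ (fun ω k => ξ k ω) P) (S : Fin n → Z) (i : Fin n) (z : Z) (k : ℕ) :
    ChiSqDominated
      (P.map fun ω => lmcIterate f β η (Function.update S i z) (w₀ ω) (fun k => ξ k ω) k)
      (P.map fun ω => lmcIterate f β η S (w₀ ω) (fun k => ξ k ω) k)
      (ENNReal.ofReal (Real.exp (L ^ 2 * (β * ∑ j ∈ Finset.Icc 1 k, η j) / (2 * n ^ 2)))) := by
  have hW : ∀ (S : Fin n → Z) k,
      Measurable fun ω => lmcIterate f β η S (w₀ ω) (fun k => ξ k ω) k := fun S k =>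
    measurable_lmcIterate hf hd β η measurable_const hw₀ (measurable_pi_lambda _ hξ) k
  induction k with
  | zero =>
    have := Measure.isProbabilityMeasure_map (μ := P) hw₀.aemeasurable
    simp only [lmcIterate]
    exact ChiSqDominated.self_of_one_le _ (by simp)
  | succ k ih =>
    set s := √(2 * η (k + 1) / β) with hs
    let F : (Fin n → Z) → EuclideanSpace ℝ (Fin d) × EuclideanSpace ℝ (Fin d) →
        EuclideanSpace ℝ (Fin d) := fun S p =>
      p.1 - (η (k + 1) / n) • ∑ i, gradient (fun v => f v (S i)) p.1 + s • p.2
    have hF : ∀ S, Measurable (F S) := fun S => by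
      have hsum : Measurable fun p : EuclideanSpace ℝ (Fin d) × EuclideanSpace ℝ (Fin d) =>
          ∑ i, gradient (fun v => f v (S i)) p.1 :=
        Finset.measurable_sum _ fun i _ =>
          (measurable_gradient_uncurry hf hd).comp (measurable_fst.prodMk measurable_const)
      exact (measurable_fst.sub (hsum.const_smul (η (k + 1) / n : ℝ))).add
        (measurable_snd.const_smul s)
    -- The fresh noise is independent of the current iterate, so one round is a Markov transition.
    have hlaw : ∀ S : Fin n → Z,
        (P.map fun ω => lmcIterate f β η S (w₀ ω) (fun k => ξ k ω) (k + 1))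
          = ((P.map fun ω => lmcIterate f β η S (w₀ ω) (fun k => ξ k ω) k).prod
              (stdGaussian (EuclideanSpace ℝ (Fin d)))).map (F S) := fun S => by
      rw [← hξlaw (k + 1), ← (indepFun_lmcIterate hf hd β η S hw₀ hξ hind hw₀ξ
        k).map_prod_eq_prod_map_map (hW S k).aemeasurable (hξ _).aemeasurable,
        Measure.map_map (hF S) ((hW S k).prodMk (hξ _))]
      rfl
    rw [hlaw, hlaw]
    have hL0 : 0 ≤ L := (norm_nonneg _).trans (hL z z 0)
    -- The drift gap `η L / n` is `s` times `√(η β / 2) L / n`, whose square is the increment of the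
    -- exponent.
    have hr : s * (√(η (k + 1) * β / 2) * L / n) = η (k + 1) / n * L := by
      have h1 : s * √(η (k + 1) * β / 2) = η (k + 1) := by
        rw [hs, ← Real.sqrt_mul (by have := hη (k + 1); positivity),
          show 2 * η (k + 1) / β * (η (k + 1) * β / 2) = η (k + 1) ^ 2 by field_simp,
          Real.sqrt_sq (hη _)]
      rw [mul_div_assoc', ← mul_assoc, h1]; ring
    have hstep := ih.map_prod (ν := stdGaussian (EuclideanSpace ℝ (Fin d)))
      (hF (Function.update S i z)) (hF S) fun w => ChiSqDominated.stdGaussian_affine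
        (w - (η (k + 1) / n) • ∑ j, gradient (fun v => f v (Function.update S i z j)) w)
        (w - (η (k + 1) / n) • ∑ j, gradient (fun v => f v (S j)) w) (Real.sqrt_nonneg _)
        (r := √(η (k + 1) * β / 2) * L / n) (by
          rw [hr, sub_sub_sub_cancel_left, ← smul_sub, norm_smul,
            Real.norm_of_nonneg (div_nonneg (hη _) n.cast_nonneg)]
          exact mul_le_mul_of_nonneg_left (norm_sum_gradient_update_sub_le hL S i z w)
            (div_nonneg (hη _) n.cast_nonneg))
    rw [← ENNReal.ofReal_mul (Real.exp_nonneg _), ← Real.exp_add] at hstep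
    convert hstep using 3
    rw [Finset.sum_Icc_succ_top (by omega), div_pow, mul_pow,
      Real.sq_sqrt (by have := hη (k + 1); positivity)]
    ring

/-- Uniform stability of Langevin Monte Carlo. -/
lemma abs_integral_lmcIterate_update_sub_le (hn : 0 < n) (hf : Measurable (Function.uncurry f))
    (hd : ∀ z, Differentiable ℝ fun w => f w z) {L : ℝ}
    (hL : ∀ z z' w, ‖gradient (fun v => f v z) w - gradient (fun v => f v z') w‖ ≤ L)
    {β : ℝ} (hβ : 0 < β) {η : ℕ → ℝ} (hη : ∀ k, 0 ≤ η k)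
    (hw₀ : Measurable w₀) (hξ : ∀ k, Measurable (ξ k))
    (hξlaw : ∀ k, P.map (ξ k) = stdGaussian (EuclideanSpace ℝ (Fin d))) (hind : iIndepFun ξ P)
    (hw₀ξ : IndepFun w₀ (fun ω k => ξ k ω) P) (S : Fin n → Z) (i : Fin n) (z : Z) (N : ℕ)
    {g : EuclideanSpace ℝ (Fin d) → ℝ} (hg : Measurable g) {C : ℝ} (hC : ∀ w, |g w| ≤ C) :
    |∫ ω, g (lmcIterate f β η (Function.update S i z) (w₀ ω) (fun k => ξ k ω) N) ∂P
        - ∫ ω, g (lmcIterate f β η S (w₀ ω) (fun k => ξ k ω) N) ∂P|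
      ≤ 2 * C * (L * √(β * ∑ k ∈ Finset.Icc 1 N, η k) / n) := by
  have hW : ∀ S : Fin n → Z,
      Measurable fun ω => lmcIterate f β η S (w₀ ω) (fun k => ξ k ω) N := fun S =>
    measurable_lmcIterate hf hd β η measurable_const hw₀ (measurable_pi_lambda _ hξ) N
  have hC0 : 0 ≤ C := (abs_nonneg _).trans (hC 0)
  have hL0 : 0 ≤ L := (norm_nonneg _).trans (hL z z 0)
  have hT0 : 0 ≤ β * ∑ k ∈ Finset.Icc 1 N, η k :=
    mul_nonneg hβ.le (Finset.sum_nonneg fun k _ => hη k)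
  have hdom := chiSqDominated_lmcIterate hf hd hL hβ hη hw₀ hξ hξlaw hind hw₀ξ S i z N
  set T := β * ∑ k ∈ Finset.Icc 1 N, η k
  set D := L * √T / n with hD
  have hD0 : 0 ≤ D := by positivity
  have hD2 : L ^ 2 * T / (2 * n ^ 2) = D ^ 2 / 2 := by
    rw [hD, div_pow, mul_pow, Real.sq_sqrt hT0]; field_simp
  rw [hD2] at hdom
  have := Measure.isProbabilityMeasure_map (μ := P) (hW S).aemeasurable
  have := Measure.isProbabilityMeasure_map (μ := P) (hW (Function.update S i z)).aemeasurable
  have hsq := hdom.sq_integral_sub_le (Real.one_le_exp (by positivity)) hg hC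
  rw [integral_map (hW _).aemeasurable hg.aestronglyMeasurable,
    integral_map (hW _).aemeasurable hg.aestronglyMeasurable] at hsq
  -- For `D²/2 ≤ 1`, the inequality `exp x - 1 ≤ 2x` gives the bound `C D`. Otherwise `D ≥ 1`, and
  -- the trivial bound `2C` is at most `2 C D`.
  rcases le_total (D ^ 2 / 2) 1 with h1 | h1
  · refine abs_le_of_sq_le_sq (hsq.trans ?_) (by positivity)
    have hq : |D ^ 2 / 2| = D ^ 2 / 2 := abs_of_nonneg (by positivity)
    have he := (le_abs_self _).trans (Real.abs_exp_sub_one_le (hq.trans_le h1))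
    rw [hq] at he
    calc _ ≤ (2 * (D ^ 2 / 2)) * C ^ 2 := by gcongr
      _ ≤ _ := by nlinarith [sq_nonneg (C * D)]
  · have hbd : ∀ S : Fin n → Z,
        |∫ ω, g (lmcIterate f β η S (w₀ ω) (fun k => ξ k ω) N) ∂P| ≤ C := fun S =>
      abs_integral_le_of_forall_abs_le P fun ω => hC _
    have hD1 : 1 ≤ D := by nlinarith
    calc _ ≤ C + C := (abs_sub _ _).trans (add_le_add (hbd _) (hbd _))
      _ ≤ _ := by nlinarith

end langevin

/-! ### From stability to generalization -/

/-- Resampling one coordinate of an i.i.d. sample preserves its law: on boxes, the factor at `i`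
passes from the old point to the fresh one. -/
lemma measurePreserving_update {n : ℕ} {Z : Type*} [MeasurableSpace Z] (D : Measure Z)
    [IsProbabilityMeasure D] (i : Fin n) :
    MeasurePreserving (fun p : (Fin n → Z) × Z => Function.update p.1 i p.2)
      ((Measure.pi fun _ : Fin n => D).prod D) (Measure.pi fun _ : Fin n => D) := by
  have hm : Measurable fun p : (Fin n → Z) × Z => Function.update p.1 i p.2 := by
    refine measurable_pi_lambda _ fun j => ?_
    by_cases hj : j = i
    · subst hj; simpa using measurable_snd
    · simp only [Function.update_of_ne hj]; fun_prop
  refine ⟨hm, (Measure.pi_eq fun s hs => ?_).symm⟩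
  rw [Measure.map_apply hm (MeasurableSet.univ_pi hs)]
  have : (fun p : (Fin n → Z) × Z => Function.update p.1 i p.2) ⁻¹' Set.univ.pi s
      = (Set.univ.pi (Function.update s i Set.univ)) ×ˢ s i := by
    ext p
    simp only [Set.mem_preimage, Set.mem_univ_pi, Set.mem_prod]
    constructor
    · refine fun h => ⟨fun j => ?_, by simpa using h i⟩
      by_cases hj : j = i
      · subst hj; simp
      · simpa [hj] using h j
    · rintro ⟨h, hi⟩ j
      by_cases hj : j = i
      · subst hj; simpa using hi
      · simpa [hj] using h j
  rw [this, Measure.prod_prod, Measure.pi_pi, ← Finset.mul_prod_erase _ _ (Finset.mem_univ i),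
    ← Finset.mul_prod_erase Finset.univ (fun j => D (s j)) (Finset.mem_univ i)]
  rw [Function.update_self, measure_univ, one_mul, mul_comm]
  congr 1
  refine Finset.prod_congr rfl fun j hj => ?_
  rw [Function.update_of_ne (Finset.ne_of_mem_erase hj)]

/-- Uniform stability implies generalization: `φ S z` is the expected loss at `z` of the parameter
learned from the sample `S`. -/
lemma abs_integral_sub_avg_le_of_stable {n : ℕ} (hn : 0 < n) {Z : Type*} [MeasurableSpace Z]
    (D : Measure Z) [IsProbabilityMeasure D] {φ : (Fin n → Z) → Z → ℝ}
    (hφ : Measurable (Function.uncurry φ)) {C : ℝ} (hC : ∀ S z, |φ S z| ≤ C) {δ : ℝ}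
    (hδ : ∀ S i z y, |φ (Function.update S i y) z - φ S z| ≤ δ) :
    |∫ S, ((∫ z, φ S z ∂D) - (1 / (n : ℝ)) * ∑ i, φ S (S i)) ∂(Measure.pi fun _ : Fin n => D)|
      ≤ δ := by
  set Q := Measure.pi fun _ : Fin n => D with hQ
  have hiprod : Integrable (Function.uncurry φ) (Q.prod D) :=
    Integrable.of_bound hφ.aestronglyMeasurable C (ae_of_all _ fun p => hC p.1 p.2)
  have hdiag : ∀ i, Measurable fun S : Fin n → Z => φ S (S i) := fun i =>
    hφ.comp (measurable_id.prodMk (measurable_pi_apply i))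
  have hidiag : ∀ i, Integrable (fun S : Fin n → Z => φ S (S i)) Q := fun i =>
    Integrable.of_bound (hdiag i).aestronglyMeasurable C (ae_of_all _ fun S => hC S _)
  have hone : ∀ i, |∫ S, (∫ z, φ S z ∂D) ∂Q - ∫ S, φ S (S i) ∂Q| ≤ δ := fun i => by
    have hmp := measurePreserving_update D i
    -- After resampling, the test point is the fresh draw `z` and the training sample is `S` with
    -- `z` in slot `i`, so the gap is a one-point replacement.
    have e : ∫ S, φ S (S i) ∂Q = ∫ p, φ (Function.update p.1 i p.2) p.2 ∂(Q.prod D) := by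
      conv_lhs => rw [hQ, ← hmp.map_eq]
      rw [integral_map hmp.measurable.aemeasurable (hdiag i).aestronglyMeasurable]
      simp [hQ]
    have hi2 : Integrable (fun p : (Fin n → Z) × Z => φ (Function.update p.1 i p.2) p.2)
        (Q.prod D) :=
      Integrable.of_bound (hφ.comp (hmp.measurable.prodMk measurable_snd)).aestronglyMeasurable C
        (ae_of_all _ fun p => hC _ _)
    have e1 : ∫ S, (∫ z, φ S z ∂D) ∂Q = ∫ p, Function.uncurry φ p ∂(Q.prod D) :=
      (integral_prod _ hiprod).symm
    rw [e, e1, abs_sub_comm, ← integral_sub hi2 hiprod]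
    exact abs_integral_le_of_forall_abs_le (Q.prod D) fun p => hδ p.1 i p.2 p.2
  have hn' : (n : ℝ) ≠ 0 := by positivity
  rw [integral_sub (show Integrable (fun S => ∫ z, φ S z ∂D) Q from hiprod.integral_prod_left)
    ((integrable_finsetSum _ fun i _ => hidiag i).const_mul _), integral_const_mul,
    integral_finsetSum _ fun i _ => hidiag i]
  have hrew : ∫ S, (∫ z, φ S z ∂D) ∂Q - 1 / (n : ℝ) * ∑ i, ∫ S, φ S (S i) ∂Q
      = 1 / (n : ℝ) * ∑ i : Fin n, (∫ S, (∫ z, φ S z ∂D) ∂Q - ∫ S, φ S (S i) ∂Q) := by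
    rw [Finset.sum_sub_distrib]
    simp only [Finset.sum_const, Finset.card_univ, Fintype.card_fin, nsmul_eq_mul]
    field_simp
  rw [hrew, abs_mul, abs_of_nonneg (by positivity)]
  calc _ ≤ 1 / (n : ℝ) * ∑ _i : Fin n, δ := by
        gcongr
        exact (Finset.abs_sum_le_sum_abs _ _).trans (Finset.sum_le_sum fun i _ => hone i)
    _ = δ := by
        simp only [Finset.sum_const, Finset.card_univ, Fintype.card_fin, nsmul_eq_mul]
        field_simp

/-- Fubini puts the error in terms of the expected loss at each data point, the form used by the
stability argument. -/
lemma genError_eq {d n : ℕ} {Z Ω : Type*} [MeasurableSpace Z] [MeasurableSpace Ω]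
    {ℓ : EuclideanSpace ℝ (Fin d) → Z → ℝ} (hℓ : Measurable (Function.uncurry ℓ)) {C : ℝ}
    (hC : ∀ w z, |ℓ w z| ≤ C) (D : Measure Z) [IsProbabilityMeasure D] (P : Measure Ω)
    [IsProbabilityMeasure P] (S : Fin n → Z) {W : Ω → EuclideanSpace ℝ (Fin d)}
    (hW : Measurable W) :
    genError ℓ D P S W
      = (∫ z, ∫ ω, ℓ (W ω) z ∂P ∂D) - (1 / (n : ℝ)) * ∑ i, ∫ ω, ℓ (W ω) (S i) ∂P := by
  have hint : Integrable (Function.uncurry fun ω z => ℓ (W ω) z) (P.prod D) :=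
    Integrable.of_bound
      (hℓ.comp ((hW.comp measurable_fst).prodMk measurable_snd)).aestronglyMeasurable C
      (ae_of_all _ fun p => hC _ _)
  have hi : ∀ i, Integrable (fun ω => ℓ (W ω) (S i)) P := fun i =>
    Integrable.of_bound (hℓ.comp (hW.prodMk measurable_const)).aestronglyMeasurable C
      (ae_of_all _ fun p => hC _ _)
  rw [genError, integral_sub
    (show Integrable (fun ω => ∫ z, ℓ (W ω) z ∂D) P from hint.integral_prod_left)
    ((integrable_finsetSum _ fun i _ => hi i).const_mul _), integral_const_mul,
    integral_finsetSum _ fun i _ => hi i, integral_integral_swap hint]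

theorem theorem5 :
    ∃ K : ℝ, 0 < K ∧
      ∀ (d n N : ℕ) (_hn : 0 < n)
        -- the data space and the data distribution
        (Z : Type*) [MeasurableSpace Z] (D : Measure Z) [IsProbabilityMeasure D]
        -- the objective: differentiable, with gradients at different data points `L`-close
        (f : EuclideanSpace ℝ (Fin d) → Z → ℝ) (_hfm : Measurable (Function.uncurry f))
        (_hfd : ∀ z, Differentiable ℝ (fun w => f w z))
        (L : ℝ)
        (_hL : ∀ z z' w,
          ‖gradient (fun v => f v z) w - gradient (fun v => f v z') w‖ ≤ L)
        -- the loss: measurable and bounded by `C`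
        (ℓ : EuclideanSpace ℝ (Fin d) → Z → ℝ) (_hℓm : Measurable (Function.uncurry ℓ))
        (C : ℝ) (_hC : ∀ w z, |ℓ w z| ≤ C)
        -- inverse temperature, step sizes, scale of the initialization
        (β : ℝ) (_hβ : 0 < β) (η : ℕ → ℝ) (_hη : ∀ k, 0 ≤ η k) (σ₀ : ℝ) (_hσ : 0 ≤ σ₀)
        -- the randomness of the algorithm: Gaussian initial point and Gaussian noise
        (Ω : Type*) [MeasurableSpace Ω] (P : Measure Ω) [IsProbabilityMeasure P]
        (w₀ : Ω → EuclideanSpace ℝ (Fin d)) (_hw₀m : Measurable w₀)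
        (_hw₀ : P.map w₀ = (stdGaussian (EuclideanSpace ℝ (Fin d))).map (fun x => σ₀ • x))
        (ξ : ℕ → Ω → EuclideanSpace ℝ (Fin d)) (_hξm : ∀ k, Measurable (ξ k))
        (_hξ : ∀ k, P.map (ξ k) = stdGaussian (EuclideanSpace ℝ (Fin d)))
        (_hξind : iIndepFun ξ P) (_hw₀ξ : IndepFun w₀ (fun ω k => ξ k ω) P),
        |∫ S : Fin n → Z,
            genError ℓ D P S (fun ω => lmcIterate f β η S (w₀ ω) (fun k => ξ k ω) N)
            ∂(Measure.pi fun _ : Fin n => D)|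
          ≤ K * C * (L * √(β * ∑ k ∈ Finset.Icc 1 N, η k) / n) := by
  refine ⟨2, two_pos, ?_⟩
  intro d n N hn Z _ D _ f hf hd L hL ℓ hℓ C hC β hβ η hη σ₀ _ Ω _ P _ w₀ hw₀ _ ξ hξ hξlaw hind hw₀ξ
  have hW : ∀ S : Fin n → Z,
      Measurable fun ω => lmcIterate f β η S (w₀ ω) (fun k => ξ k ω) N := fun S =>
    measurable_lmcIterate hf hd β η measurable_const hw₀ (measurable_pi_lambda _ hξ) N
  have hφ : Measurable fun p : (Fin n → Z) × Z =>
      ∫ ω, ℓ (lmcIterate f β η p.1 (w₀ ω) (fun k => ξ k ω) N) p.2 ∂P := by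
    have hm : Measurable fun q : ((Fin n → Z) × Z) × Ω =>
        ℓ (lmcIterate f β η q.1.1 (w₀ q.2) (fun k => ξ k q.2) N) q.1.2 :=
      hℓ.comp ((measurable_lmcIterate hf hd β η (by fun_prop) (by fun_prop)
        (measurable_pi_lambda _ fun k => by fun_prop) N).prodMk (by fun_prop))
    exact hm.stronglyMeasurable.integral_prod_right'.measurable
  simp_rw [genError_eq hℓ hC D P _ (hW _)]
  refine abs_integral_sub_avg_le_of_stable hn D (C := C)
    (φ := fun S z => ∫ ω, ℓ (lmcIterate f β η S (w₀ ω) (fun k => ξ k ω) N) z ∂P) hφ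
    (fun S z => ?_) fun S i z y => ?_
  · exact abs_integral_le_of_forall_abs_le P fun ω => hC _ z
  · exact abs_integral_lmcIterate_update_sub_le hn hf hd hL hβ hη hw₀ hξ hξlaw hind hw₀ξ S i y N
      (hℓ.comp measurable_prodMk_right) fun w => hC w z
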